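/- All logarithms are to base 2. For a random variable $Y\in\{0,1\}^n$ with distribution $\mathbf{P}_Y$ let $\mathbf{H}_1(Y)=-\sum_x \mathbf{P}_Y(x)\log \mathbf{P}_Y(x)$ be its Shannon entropy. For a class $\mathcal{D}$ of (deterministic or randomized) distinguishers on $\{0,1\}^n$ and $\epsilon\ge 0$, a random variable $X\in\{0,1\}^n$ has at least $k$ bits of metric Shannon entropy against $(\mathcal{D},\epsilon)$ if for every $D\in\mathcal{D}$ there is a random variable $Y\in\{0,1\}^n$ with $\mathbf{H}_1(Y)\ge k$ and $|\mathbf{E}D(X)-\mathbf{E}D(Y)|\le\epsilon$, where the expectation is also over the coins of $D$ if $D$ is randomized; $\mathbf{H}_1^{\mathrm{Metric},\mathcal{D},\epsilon}(X)$ denotes the supremum of all such $k$. Let $\det\{0,1\}$ be the class of all functions $\{0,1\}^n\to\{0,1\}$, and let $\mathrm{rand}\{0,1\}$ be the class of all randomized boolean circuits on $\{0,1\}^n$, of unbounded size and with any finite number of uniform independent random coins. **Corollary.** There are absolute constants $c\in(0,1)$, $\delta>0$ and $\epsilon>0$ such that for every $n\ge 2$ there exist a random variable $X\in\{0,1\}^n$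 and a real number $k\ge cn$ with 1. $\mathbf{H}_1^{\mathrm{Metric},\det\{0,1\},0}(X)=k$, and 2. $\mathbf{H}_1^{\mathrm{Metric},\mathrm{rand}\{0,1\},\epsilon}(X)\le k-\delta n$. -/

import Mathlib

namespace MetricEntropy

/-- The cube `{0,1}^n`. -/
abbrev Cube (n : ℕ) : Type := Fin n → Bool

/-- The distributions of random variables with values in `{0,1}^n`, as probability vectors. -/
abbrev Dist (n : ℕ) : Type := stdSimplex ℝ (Cube n)

/-- Shannon entropy in bits (`0 * logb 2 0 = 0`). -/
noncomputable def shannonEntropy {n : ℕ} (X : Dist n) : ℝ :=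
  -∑ x, X.1 x * Real.logb 2 (X.1 x)

/-- The expectation `E D(X)`. -/
def expect {n : ℕ} (D : Cube n → ℝ) (X : Dist n) : ℝ :=
  ∑ x, X.1 x * D x

/-- `X` has at least `k` bits of metric Shannon entropy against `(𝒟, ε)`. -/
def HasMetricShannonEntropy {n : ℕ} (𝒟 : Set (Cube n → ℝ)) (ε : ℝ) (X : Dist n) (k : ℝ) : Prop :=
  ∀ D ∈ 𝒟, ∃ Y : Dist n, k ≤ shannonEntropy Y ∧ |expect D X - expect D Y| ≤ ε

/-- The metric Shannon entropy of `X` against `(𝒟, ε)`: the largest number of bits that it has. -/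
noncomputable def metricShannonEntropy {n : ℕ} (𝒟 : Set (Cube n → ℝ)) (ε : ℝ) (X : Dist n) : ℝ :=
  sSup {k : ℝ | HasMetricShannonEntropy 𝒟 ε X k}

/-- The class of all deterministic boolean functions on `{0,1}^n`, as `0`-`1`-valued functions. -/
def detBool (n : ℕ) : Set (Cube n → ℝ) :=
  {D | ∃ f : Cube n → Bool, D = fun x => if f x = true then 1 else 0}

/-- A gate reading some of `w` wires already computed. -/
inductive Gate (w : ℕ) : Type
  | const (b : Bool) : Gate w
  | not (i : Fin w) : Gate w
  | and (i j : Fin w) : Gate w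
  | or (i j : Fin w) : Gate w

/-- The value of a gate, given the values of the wires. -/
def Gate.eval {w : ℕ} (v : Fin w → Bool) : Gate w → Bool
  | .const b => b
  | .not i => !(v i)
  | .and i j => v i && v j
  | .or i j => v i || v j

/-- Straight-line programs with `N` inputs: `Program N w` has `w` wires, namely the inputs,
followed by one wire for each gate. -/
inductive Program (N : ℕ) : ℕ → Type
  | inputs : Program N N
  | addGate {w : ℕ} (P : Program N w) (g : Gate w) : Program N (w + 1)

/-- The values of all wires on a given input. -/
def Program.wires {N : ℕ} (a : Cube N) : {w : ℕ} → Program N w → (Fin w → Bool)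
  | _, .inputs => a
  | _, .addGate P g => Fin.snoc (α := fun _ => Bool) (P.wires a) (g.eval (P.wires a))

/-- Boolean circuits with `N` inputs, one output, and unbounded fan-out. -/
structure Circuit (N : ℕ) : Type where
  numWires : ℕ
  program : Program N numWires
  output : Fin numWires

/-- The boolean function computed by a circuit. -/
def Circuit.eval {N : ℕ} (C : Circuit N) (a : Cube N) : Bool :=
  C.program.wires a C.output

/-- The probability that a circuit with `n` inputs and `m` random inputs accepts `x`, over
uniform independent coins. -/
noncomputable def acceptProb {n m : ℕ} (C : Circuit (n + m)) (x : Cube n) : ℝ :=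
  (Finset.univ.filter fun r : Cube m => C.eval (Fin.append x r) = true).card / 2 ^ m

/-- The class of all randomized boolean circuits on `{0,1}^n`, of unbounded size and with any
number of random coins. A randomized circuit enters expectations only through its acceptance
probabilities. -/
def randCircuits (n : ℕ) : Set (Cube n → ℝ) :=
  {D | ∃ (m : ℕ) (C : Circuit (n + m)), D = acceptProb C}

/-! The supremum that defines metric entropy is over a non-empty set that is bounded above. -/

theorem metricSet_nonempty {n : ℕ} (𝒟 : Set (Cube n → ℝ)) {ε : ℝ} (hε : 0 ≤ ε) (X : Dist n) :
    {k : ℝ | HasMetricShannonEntropy 𝒟 ε X k}.Nonempty :=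
  ⟨shannonEntropy X, fun _ _ => ⟨X, le_rfl, by simpa using hε⟩⟩

theorem shannonEntropy_le {n : ℕ} (X : Dist n) :
    shannonEntropy X ≤ ∑ _x : Cube n, 1 / Real.log 2 := by
  unfold shannonEntropy
  rw [← Finset.sum_neg_distrib]
  refine Finset.sum_le_sum fun x _ => ?_
  have h0 : 0 ≤ X.1 x := X.2.1 x
  have h2 : 0 < Real.log 2 := Real.log_pos one_lt_two
  have h : -(X.1 x * Real.logb 2 (X.1 x)) = Real.negMulLog (X.1 x) / Real.log 2 := by
    simp only [Real.logb, Real.negMulLog]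
    ring
  rw [h]
  refine div_le_div_of_nonneg_right ?_ h2.le
  rcases h0.eq_or_lt with h0 | h0
  · rw [← h0]; simp
  · have h3 := mul_le_mul_of_nonneg_left (Real.one_sub_inv_le_log_of_pos h0) h0.le
    rw [mul_sub, mul_inv_cancel₀ h0.ne'] at h3
    unfold Real.negMulLog
    linarith

theorem metricSet_bddAbove {n : ℕ} {𝒟 : Set (Cube n → ℝ)} (h𝒟 : 𝒟.Nonempty) (ε : ℝ)
    (X : Dist n) : BddAbove {k : ℝ | HasMetricShannonEntropy 𝒟 ε X k} := by
  obtain ⟨D, hD⟩ := h𝒟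
  refine ⟨∑ _x : Cube n, 1 / Real.log 2, fun k hk => ?_⟩
  obtain ⟨Y, hY, -⟩ := hk D hD
  exact hY.trans (shannonEntropy_le Y)

theorem detBool_nonempty (n : ℕ) : (detBool n).Nonempty :=
  ⟨_, fun _ => true, rfl⟩

theorem randCircuits_nonempty (n : ℕ) : (randCircuits n).Nonempty :=
  ⟨_, 0, ⟨_, .addGate .inputs (.const true), Fin.last _⟩, rfl⟩

end MetricEntropy

namespace MetricEntropy

/-! ### Every boolean function is computed by a circuit -/

/-! Let `D` take the value 1 at one point, 1/2 on a set `A` of size 2^⌊n/2⌋ and 0 elsewhere, and let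
`X` have mass proportional to 2^(tD) with t = 2⌊n/2⌋. The log-density of `X` is affine in `D`, so by
Gibbs' inequality every `Y` with |E D(X) - E D(Y)| ≤ ε has entropy at most H(X) + tε ≤ H(X) + nε
(`shannonEntropy_le_of_affine`). One coin realizes `D`, which bounds the randomized metric entropy.

A deterministic distinguisher has only two values, so it confuses large parts of two of the three
levels. Averaging `X` over these parts keeps the expectation and raises the entropy
(`exists_merge`). The point and `A` each have mass at least 1/4 and the level sizes are
exponentially separated, so for large n the gain is linear in n (`foolsWithGain_of_levels`). For the
finitely many small n, three distinct masses already force a positive gain (`exists_foolsWithGain`).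
Taking ε to be half the gain per bit leaves a linear gap. -/

theorem Program.le {N w : ℕ} (P : Program N w) : N ≤ w := by
  induction P with
  | inputs => exact le_rfl
  | addGate P g ih => omega

theorem Program.wires_input {N w : ℕ} (P : Program N w) (a : Cube N) (i : Fin N) :
    P.wires a (Fin.castLE P.le i) = a i := by
  induction P with
  | inputs => rfl
  | addGate P g ih =>
    have : Fin.castLE (P.addGate g).le i = Fin.castSucc (Fin.castLE P.le i) := rfl
    rw [this]
    simp only [Program.wires]
    rw [Fin.snoc_castSucc]
    exact ih

/-- `Q` starts with the wires of `P`. -/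
def Program.Extends {N w w' : ℕ} (Q : Program N w') (P : Program N w) : Prop :=
  ∃ h : w ≤ w', ∀ a i, Q.wires a (Fin.castLE h i) = P.wires a i

theorem Program.Extends.trans {N w w' w'' : ℕ} {R : Program N w''} {Q : Program N w'}
    {P : Program N w} (h : R.Extends Q) (h' : Q.Extends P) : R.Extends P := by
  obtain ⟨h₁, e₁⟩ := h
  obtain ⟨h₂, e₂⟩ := h'
  exact ⟨h₂.trans h₁, fun a i => (e₁ a (Fin.castLE h₂ i)).trans (e₂ a i)⟩

theorem Program.addGate_extends {N w : ℕ} (P : Program N w) (g : Gate w) :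
    (P.addGate g).Extends P :=
  ⟨Nat.le_succ w, fun a i => by
    have : Fin.castLE (Nat.le_succ w) i = Fin.castSucc i := rfl
    rw [this]
    simp only [Program.wires]
    rw [Fin.snoc_castSucc]⟩

theorem Program.addGate_last {N w : ℕ} (P : Program N w) (g : Gate w) (a : Cube N) :
    (P.addGate g).wires a (Fin.last w) = g.eval (P.wires a) := by
  simp only [Program.wires]
  rw [Fin.snoc_last]

/-- Every program can be extended by gates that compute `f`. -/
def Computes {N : ℕ} (f : Cube N → Bool) : Prop :=
  ∀ (w : ℕ) (P : Program N w), ∃ (w' : ℕ) (Q : Program N w'), Q.Extends P ∧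
    ∃ o, ∀ a, Q.wires a o = f a

theorem Computes.const {N : ℕ} (b : Bool) : Computes fun _ : Cube N => b :=
  fun w P => ⟨w + 1, P.addGate (.const b), P.addGate_extends _, Fin.last w,
    fun a => P.addGate_last _ a⟩

theorem Computes.input {N : ℕ} (i : Fin N) : Computes fun a : Cube N => a i :=
  fun w P => ⟨w, P, ⟨le_rfl, fun _ _ => rfl⟩, Fin.castLE P.le i, fun a => P.wires_input a i⟩

theorem Computes.not {N : ℕ} {f : Cube N → Bool} (hf : Computes f) :
    Computes fun a => !(f a) := by
  intro w P
  obtain ⟨w₁, Q, hQ, o, ho⟩ := hf w P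
  refine ⟨w₁ + 1, Q.addGate (.not o), (Q.addGate_extends _).trans hQ, Fin.last w₁, fun a => ?_⟩
  rw [Q.addGate_last, Gate.eval, ho]

/-- Since `Computes` allows any starting program, the gates for `g` can be placed after those for
`f`, whose output wire survives. -/
theorem Computes.and {N : ℕ} {f g : Cube N → Bool} (hf : Computes f) (hg : Computes g) :
    Computes fun a => f a && g a := by
  intro w P
  obtain ⟨w₁, Q, hQ, o, ho⟩ := hf w P
  obtain ⟨w₂, R, hR, o', ho'⟩ := hg w₁ Q
  have hR' := hR
  obtain ⟨hle, he⟩ := hR'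
  refine ⟨w₂ + 1, R.addGate (.and (Fin.castLE hle o) o'),
    (R.addGate_extends _).trans (hR.trans hQ), Fin.last w₂, fun a => ?_⟩
  rw [R.addGate_last, Gate.eval, ho', he, ho]

theorem Computes.or {N : ℕ} {f g : Cube N → Bool} (hf : Computes f) (hg : Computes g) :
    Computes fun a => f a || g a := by
  have := (hf.not.and hg.not).not
  simpa using this

theorem Computes.decide_eq {N : ℕ} (b : Cube N) (s : Finset (Fin N)) :
    Computes fun a : Cube N => decide (∀ i ∈ s, a i = b i) := by
  induction s using Finset.induction_on with
  | empty => simpa using Computes.const true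
  | insert i s hi ih =>
    have h : Computes fun a : Cube N => decide (a i = b i) := by
      cases hb : b i
      · simpa using (Computes.input i).not
      · simpa using Computes.input i
    simpa [Finset.forall_mem_insert] using h.and ih

/-- Disjunctive normal form: a disjunction of the point indicators from `Computes.decide_eq`. -/
theorem Computes.decide_mem {N : ℕ} (S : Finset (Cube N)) :
    Computes fun a : Cube N => decide (a ∈ S) := by
  induction S using Finset.induction_on with
  | empty => simpa using Computes.const false
  | insert b S hb ih =>
    have h := (Computes.decide_eq b Finset.univ).or ih
    simpa [← funext_iff] using h

theorem exists_circuit_eval {N : ℕ} (f : Cube N → Bool) : ∃ C : Circuit N, C.eval = f := by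
  have h : Computes f := by
    simpa using Computes.decide_mem (Finset.univ.filter fun a => f a = true)
  obtain ⟨w, Q, -, o, ho⟩ := h N .inputs
  exact ⟨⟨w, Q, o⟩, funext ho⟩

/-- The distinguisher with value `1` at `x₀`, `1/2` on `A`, and `0` elsewhere. -/
noncomputable def threeLevel {n : ℕ} (x₀ : Cube n) (A : Finset (Cube n)) : Cube n → ℝ :=
  fun x => if x = x₀ then 1 else if x ∈ A then 1 / 2 else 0

/-- A three-level distinguisher is a randomized circuit with one coin. -/
theorem threeLevel_mem_randCircuits {n : ℕ} (x₀ : Cube n) (A : Finset (Cube n)) :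
    threeLevel x₀ A ∈ randCircuits n := by
  -- The last input is the coin; it matters only on `A`, where it yields acceptance probability 1/2.
  obtain ⟨C, hC⟩ := exists_circuit_eval fun a : Cube (n + 1) =>
    decide ((fun i => a (Fin.castAdd 1 i)) = x₀) ||
      (decide ((fun i => a (Fin.castAdd 1 i)) ∈ A) && a (Fin.natAdd n 0))
  refine ⟨1, C, funext fun x => ?_⟩
  unfold threeLevel acceptProb
  simp only [hC, Fin.append_left, Fin.append_right]
  by_cases h : x = x₀
  · simp [h]
  · by_cases h' : x ∈ A
    · have : (Finset.univ.filter fun r : Cube 1 => r 0 = true).card = 1 := by decide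
      simp [h, h', this]
    · simp [h, h']

open Real

/-! ### Entropy -/

theorem shannonEntropy_eq {n : ℕ} (X : Dist n) :
    shannonEntropy X = (∑ x, negMulLog (X.1 x)) / log 2 := by
  unfold shannonEntropy negMulLog logb
  rw [Finset.sum_div, ← Finset.sum_neg_distrib]
  exact Finset.sum_congr rfl fun x _ => by ring

theorem dist_le_one {n : ℕ} (X : Dist n) (x : Cube n) : X.1 x ≤ 1 := by
  rw [← X.2.2]
  exact Finset.single_le_sum (fun y _ => X.2.1 y) (Finset.mem_univ x)

theorem shannonEntropy_nonneg {n : ℕ} (X : Dist n) : 0 ≤ shannonEntropy X := by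
  rw [shannonEntropy_eq]
  exact div_nonneg (Finset.sum_nonneg fun x _ => negMulLog_nonneg (X.2.1 x) (dist_le_one X x))
    (log_nonneg one_le_two)

/-- Gibbs' inequality. -/
theorem shannonEntropy_le_cross {n : ℕ} (X Y : Dist n) (hX : ∀ x, 0 < X.1 x) :
    shannonEntropy Y ≤ -∑ x, Y.1 x * logb 2 (X.1 x) := by
  have h2 : 0 < log 2 := log_pos one_lt_two
  -- This is log r ≤ r - 1 at r = X(x)/Y(x), multiplied by Y(x); the right-hand sides sum to 0.
  have key : ∀ x, Y.1 x * log (X.1 x) - Y.1 x * log (Y.1 x) ≤ X.1 x - Y.1 x := by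
    intro x
    rcases (Y.2.1 x).eq_or_lt with h | h
    · have := (hX x).le
      rw [← h]; simpa using this
    · have h1 := mul_le_mul_of_nonneg_left (log_le_sub_one_of_pos (div_pos (hX x) h)) h.le
      rw [log_div (hX x).ne' h.ne', mul_sub, mul_sub, mul_div_cancel₀ _ h.ne'] at h1
      linarith
  have hs := Finset.sum_le_sum fun x (_ : x ∈ Finset.univ) => key x
  rw [Finset.sum_sub_distrib, Finset.sum_sub_distrib, X.2.2, Y.2.2] at hs
  unfold shannonEntropy logb
  simp only [mul_div_assoc', ← Finset.sum_div]
  rw [neg_le_neg_iff]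
  exact div_le_div_of_nonneg_right (by linarith) h2.le

/-- A distribution whose log-density is affine in `D` nearly maximizes the entropy among the
distributions with nearly the same expectation of `D`. -/
theorem shannonEntropy_le_of_affine {n : ℕ} (X : Dist n) (hX : ∀ x, 0 < X.1 x)
    (D : Cube n → ℝ) (t L : ℝ) (hD : ∀ x, logb 2 (X.1 x) = t * D x - L) (Y : Dist n) :
    shannonEntropy Y ≤ shannonEntropy X + t * (expect D X - expect D Y) := by
  -- The cross entropy relative to `X` depends on `Z` only through the expectation of `D`; at `Z =
  -- X` it is the entropy of `X`.
  have h : ∀ Z : Dist n, -∑ x, Z.1 x * logb 2 (X.1 x) = L - t * expect D Z := by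
    intro Z
    have : ∀ x, Z.1 x * logb 2 (X.1 x) = t * (Z.1 x * D x) - Z.1 x * L := fun x => by
      rw [hD]; ring
    simp only [this]
    rw [Finset.sum_sub_distrib, ← Finset.mul_sum, ← Finset.sum_mul, Z.2.2, expect]
    ring
  have h1 := shannonEntropy_le_cross X Y hX
  rw [h] at h1
  have h2 : shannonEntropy X = L - t * expect D X := h X
  linarith

/-- The gain in entropy, in nats, when `k` atoms of mass `a` and `l` atoms of mass `b` are
averaged. -/
noncomputable def mergeGain (k l a b : ℝ) : ℝ :=
  (k + l) * negMulLog ((k * a + l * b) / (k + l)) - k * negMulLog a - l * negMulLog b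

/-- Strict Jensen for `negMulLog` with weights k/(k+l) and l/(k+l). -/
theorem mergeGain_pos {k l a b : ℝ} (hk : 0 < k) (hl : 0 < l) (ha : 0 ≤ a) (hb : 0 ≤ b)
    (hab : a ≠ b) : 0 < mergeGain k l a b := by
  have hkl : 0 < k + l := add_pos hk hl
  have h := strictConcaveOn_negMulLog.2 (Set.mem_Ici.2 ha) (Set.mem_Ici.2 hb) hab
    (div_pos hk hkl) (div_pos hl hkl) (by field_simp)
  simp only [smul_eq_mul] at h
  have e : k / (k + l) * a + l / (k + l) * b = (k * a + l * b) / (k + l) := by ring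
  rw [e] at h
  have h' := mul_lt_mul_of_pos_left h hkl
  have e' : (k + l) * (k / (k + l) * negMulLog a + l / (k + l) * negMulLog b) =
      k * negMulLog a + l * negMulLog b := by field_simp
  unfold mergeGain
  linarith

/-- With u = ka and v = lb the gain is u log((k+l)/k) + v log((k+l)/l) minus (u+v) log(u+v) - u log
u - v log v. Midpoint concavity bounds the subtracted term by (u+v) log 2 ≤ log 2. -/
theorem le_mergeGain {k l a b : ℝ} (hk : 0 < k) (hl : 0 < l) (ha : 0 < a) (hb : 0 < b)
    (h1 : k * a + l * b ≤ 1) : k * a * log (l / k) - log 2 ≤ mergeGain k l a b := by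
  set u := k * a with hu
  set v := l * b with hv
  have hu0 : 0 < u := mul_pos hk ha
  have hv0 : 0 < v := mul_pos hl hb
  have hkl : 0 < k + l := add_pos hk hl
  have e1 : k * negMulLog a = u * log k - u * log u := by
    rw [hu, log_mul hk.ne' ha.ne', negMulLog]; ring
  have e2 : l * negMulLog b = v * log l - v * log v := by
    rw [hv, log_mul hl.ne' hb.ne', negMulLog]; ring
  have e3 : (k + l) * negMulLog ((u + v) / (k + l)) =
      (u + v) * log (k + l) - (u + v) * log (u + v) := by
    rw [negMulLog, log_div (by positivity) hkl.ne']
    field_simp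
    ring
  have hc := concaveOn_negMulLog.2 (Set.mem_Ici.2 hu0.le) (Set.mem_Ici.2 hv0.le)
    (by norm_num : (0 : ℝ) ≤ 1 / 2) (by norm_num : (0 : ℝ) ≤ 1 / 2) (by norm_num)
  simp only [smul_eq_mul] at hc
  have e4 : (1 / 2 : ℝ) * u + 1 / 2 * v = (u + v) / 2 := by ring
  rw [e4] at hc
  simp only [negMulLog] at hc
  rw [log_div (by positivity) two_ne_zero] at hc
  have h2 : 0 < log 2 := log_pos one_lt_two
  have h5 : (u + v) * log 2 ≤ 1 * log 2 := mul_le_mul_of_nonneg_right h1 h2.le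
  have h6 : u * log l ≤ u * log (k + l) :=
    mul_le_mul_of_nonneg_left (log_le_log hl (by linarith)) hu0.le
  have h7 : v * log l ≤ v * log (k + l) :=
    mul_le_mul_of_nonneg_left (log_le_log hl (by linarith)) hv0.le
  unfold mergeGain
  rw [e1, e2, e3, log_div hl.ne' hk.ne']
  linarith

/-- Averaging a distribution over two sets of atoms that a distinguisher does not separate. -/
theorem exists_merge {n : ℕ} (X : Dist n) (D : Cube n → ℝ) (d : ℝ) (U V : Finset (Cube n))
    (hUV : Disjoint U V) (hU : U.Nonempty) {a b : ℝ} (ha : ∀ x ∈ U, X.1 x = a)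
    (hb : ∀ x ∈ V, X.1 x = b) (hDU : ∀ x ∈ U, D x = d) (hDV : ∀ x ∈ V, D x = d) :
    ∃ Y : Dist n, expect D Y = expect D X ∧
      shannonEntropy Y = shannonEntropy X + mergeGain U.card V.card a b / log 2 := by
  have hk : (0 : ℝ) < U.card := by exact_mod_cast hU.card_pos
  have hl : (0 : ℝ) ≤ V.card := Nat.cast_nonneg _
  have hkl : (0 : ℝ) < U.card + V.card := by linarith
  have ha0 : 0 ≤ a := by
    obtain ⟨x, hx⟩ := hU
    rw [← ha x hx]; exact X.2.1 x
  -- If `V` is empty then `b` is arbitrary, so only the product is known to be nonnegative.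
  have hb0 : 0 ≤ V.card * b := by
    rcases V.eq_empty_or_nonempty with h | ⟨x, hx⟩
    · simp [h]
    · rw [← hb x hx]; exact mul_nonneg hl (X.2.1 x)
  set q : ℝ := (U.card * a + V.card * b) / (U.card + V.card) with hq
  have hq0 : 0 ≤ q := by positivity
  have hqm : (U.card + V.card) * q = U.card * a + V.card * b := by
    rw [hq]; field_simp
  set y : Cube n → ℝ := fun x => if x ∈ U ∪ V then q else X.1 x with hy
  have split : ∀ F : ℝ → Cube n → ℝ, ∀ z : Cube n → ℝ, ∑ x, F (z x) x =
      ∑ x ∈ U, F (z x) x + ∑ x ∈ V, F (z x) x + ∑ x ∈ (U ∪ V)ᶜ, F (z x) x := by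
    intro F z
    rw [← Finset.sum_union hUV, Finset.sum_add_sum_compl]
  have hyU : ∀ x ∈ U, y x = q := fun x hx => if_pos (Finset.mem_union_left _ hx)
  have hyV : ∀ x ∈ V, y x = q := fun x hx => if_pos (Finset.mem_union_right _ hx)
  have hyC : ∀ x ∈ (U ∪ V)ᶜ, y x = X.1 x := fun x hx => if_neg (Finset.mem_compl.1 hx)
  -- One computation serves for the total mass, the expectation of `D` and the entropy.
  have change : ∀ F : ℝ → Cube n → ℝ, ∀ G : ℝ → ℝ, (∀ r, ∀ x ∈ U, F r x = G r) →
      (∀ r, ∀ x ∈ V, F r x = G r) → ∑ x, F (y x) x =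
        ∑ x, F (X.1 x) x + ((U.card + V.card) * G q - U.card * G a - V.card * G b) := by
    intro F G hFU hFV
    have h₁ : ∑ x ∈ U, F (y x) x = ∑ x ∈ U, G q :=
      Finset.sum_congr rfl fun x hx => by rw [hyU x hx, hFU _ x hx]
    have h₂ : ∑ x ∈ V, F (y x) x = ∑ x ∈ V, G q :=
      Finset.sum_congr rfl fun x hx => by rw [hyV x hx, hFV _ x hx]
    have h₃ : ∑ x ∈ (U ∪ V)ᶜ, F (y x) x = ∑ x ∈ (U ∪ V)ᶜ, F (X.1 x) x :=
      Finset.sum_congr rfl fun x hx => by rw [hyC x hx]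
    have h₄ : ∑ x ∈ U, F (X.1 x) x = ∑ x ∈ U, G a :=
      Finset.sum_congr rfl fun x hx => by rw [ha x hx, hFU _ x hx]
    have h₅ : ∑ x ∈ V, F (X.1 x) x = ∑ x ∈ V, G b :=
      Finset.sum_congr rfl fun x hx => by rw [hb x hx, hFV _ x hx]
    rw [split F y, split F X.1, h₁, h₂, h₃, h₄, h₅]
    simp only [Finset.sum_const, nsmul_eq_mul]
    ring
  have hy1 : ∑ x, y x = 1 := by
    rw [change (fun r _ => r) id (fun _ _ _ => rfl) (fun _ _ _ => rfl), X.2.2]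
    simp only [id]
    linarith
  have hy0 : ∀ x, 0 ≤ y x := fun x => by
    simp only [hy]
    split_ifs
    · exact hq0
    · exact X.2.1 x
  refine ⟨⟨y, hy0, hy1⟩, ?_, ?_⟩
  · unfold expect
    rw [change (fun r x => r * D x) (fun r => r * d) (fun r x hx => by rw [hDU x hx])
      (fun r x hx => by rw [hDV x hx])]
    linear_combination d * hqm
  · rw [shannonEntropy_eq, shannonEntropy_eq, ← add_div]
    congr 1
    exact change (fun r _ => negMulLog r) negMulLog (fun _ _ _ => rfl) (fun _ _ _ => rfl)

/-! ### Gain in entropy over a deterministic distinguisher -/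

/-- Every deterministic boolean distinguisher is fooled by a distribution with `g` more bits of
entropy than `X`. -/
def FoolsWithGain {n : ℕ} (X : Dist n) (g : ℝ) : Prop :=
  ∀ D ∈ detBool n, ∃ Y : Dist n, expect D Y = expect D X ∧ shannonEntropy X + g ≤ shannonEntropy Y

theorem FoolsWithGain.mono {n : ℕ} {X : Dist n} {g g' : ℝ} (h : FoolsWithGain X g)
    (hg : g' ≤ g) : FoolsWithGain X g' := fun D hD => by
  obtain ⟨Y, h₁, h₂⟩ := h D hD
  exact ⟨Y, h₁, by linarith⟩

/-- A distribution with at least three distinct masses is not determined, as a maximizer of the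
entropy, by any single boolean distinguisher. -/
theorem exists_foolsWithGain {n : ℕ} (X : Dist n) (x y z : Cube n) (hxy : X.1 x ≠ X.1 y)
    (hyz : X.1 y ≠ X.1 z) (hxz : X.1 x ≠ X.1 z) : ∃ g > 0, FoolsWithGain X g := by
  have h2 : 0 < log 2 := log_pos one_lt_two
  have pos : ∀ u v : Cube n, X.1 u ≠ X.1 v → 0 < mergeGain 1 1 (X.1 u) (X.1 v) / log 2 :=
    fun u v h => div_pos (mergeGain_pos one_pos one_pos (X.2.1 u) (X.2.1 v) h) h2
  have merge : ∀ (D : Cube n → ℝ) (u v : Cube n), X.1 u ≠ X.1 v → D u = D v →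
      ∃ Y : Dist n, expect D Y = expect D X ∧
        shannonEntropy Y = shannonEntropy X + mergeGain 1 1 (X.1 u) (X.1 v) / log 2 := by
    intro D u v h hD
    have hne : u ≠ v := fun e => h (by rw [e])
    have := exists_merge X D (D u) {u} {v} (by simpa using hne) (by simp) (a := X.1 u)
      (b := X.1 v) (by simp) (by simp) (by simp) (by simpa using hD.symm)
    simpa using this
  refine ⟨min (mergeGain 1 1 (X.1 x) (X.1 y) / log 2) (min (mergeGain 1 1 (X.1 y) (X.1 z) / log 2)
    (mergeGain 1 1 (X.1 x) (X.1 z) / log 2)), lt_min (pos _ _ hxy)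
      (lt_min (pos _ _ hyz) (pos _ _ hxz)), ?_⟩
  rintro D ⟨f, rfl⟩
  -- Pigeonhole: two of three points share a Boolean value and can be averaged.
  have hf : f x = f y ∨ f y = f z ∨ f x = f z := by
    cases f x <;> cases f y <;> cases f z <;> simp
  rcases hf with h | h | h
  · obtain ⟨Y, h₁, h₂⟩ := merge (fun x => if f x = true then 1 else 0) x y hxy (by simp only [h])
    exact ⟨Y, h₁, by rw [h₂]; gcongr; exact min_le_left _ _⟩
  · obtain ⟨Y, h₁, h₂⟩ := merge (fun x => if f x = true then 1 else 0) y z hyz (by simp only [h])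
    exact ⟨Y, h₁, by rw [h₂]; gcongr; exact (min_le_right _ _).trans (min_le_left _ _)⟩
  · obtain ⟨Y, h₁, h₂⟩ := merge (fun x => if f x = true then 1 else 0) x z hxz (by simp only [h])
    exact ⟨Y, h₁, by rw [h₂]; gcongr; exact (min_le_right _ _).trans (min_le_right _ _)⟩

/-- Averaging a set `U` of atoms with a set that is `2 ^ s` times as large gains about
`s * P(U)` bits. -/
theorem exists_merge_large {n : ℕ} (X : Dist n) (D : Cube n → ℝ) (d : ℝ) (U V : Finset (Cube n))
    (hUV : Disjoint U V) (hU : U.Nonempty) {a b : ℝ} (ha0 : 0 < a) (hb0 : 0 < b)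
    (ha : ∀ x ∈ U, X.1 x = a) (hb : ∀ x ∈ V, X.1 x = b) (hDU : ∀ x ∈ U, D x = d)
    (hDV : ∀ x ∈ V, D x = d) (s : ℕ) (hs : 2 ^ s * U.card ≤ V.card) {μ : ℝ}
    (hμ : μ ≤ U.card * a) :
    ∃ Y : Dist n, expect D Y = expect D X ∧
      shannonEntropy X + (μ * s - 1) ≤ shannonEntropy Y := by
  obtain ⟨Y, h₁, h₂⟩ := exists_merge X D d U V hUV hU ha hb hDU hDV
  refine ⟨Y, h₁, ?_⟩
  have h2 : 0 < log 2 := log_pos one_lt_two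
  have hk' : 0 < U.card := hU.card_pos
  have hk : (0 : ℝ) < U.card := by exact_mod_cast hk'
  have hl : (0 : ℝ) < V.card := by
    exact_mod_cast lt_of_lt_of_le (by positivity) hs
  have hmass : U.card * a + V.card * b ≤ 1 := by
    have e : ∑ x ∈ U ∪ V, X.1 x = U.card * a + V.card * b := by
      rw [Finset.sum_union hUV, Finset.sum_congr rfl ha, Finset.sum_congr rfl hb]
      simp
    rw [← e, ← X.2.2]
    exact Finset.sum_le_sum_of_subset_of_nonneg (Finset.subset_univ _) fun x _ _ => X.2.1 x
  have hg := le_mergeGain hk hl ha0 hb0 hmass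
  have hlog : s * log 2 ≤ log (V.card / U.card) := by
    rw [← log_pow]
    refine log_le_log (by positivity) ?_
    rw [le_div_iff₀ hk]
    exact_mod_cast hs
  rw [h₂]
  gcongr
  rw [le_div_iff₀ h2]
  have h3 : μ * (s * log 2) ≤ U.card * a * log (V.card / U.card) :=
    (mul_le_mul_of_nonneg_right hμ (by positivity)).trans
      (mul_le_mul_of_nonneg_left hlog (by positivity))
  linarith

theorem card_filter_bool {α : Type*} (A : Finset α) (f : α → Bool) (c : Bool) :
    (A.filter fun x => f x = c).card + (A.filter fun x => f x = !c).card = A.card := by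
  have := Finset.card_filter_add_card_filter_not (s := A) (fun x => f x = c)
  simpa only [← ne_eq, ← Bool.eq_not] using this

/-- A distribution with constant mass on an atom, on a middle-sized set and on a large set,
which are exponentially separated in size, has linear gain. -/
theorem foolsWithGain_of_levels {n : ℕ} (X : Dist n) (x₀ : Cube n) (A B : Finset (Cube n))
    (hA : x₀ ∉ A) (hB : x₀ ∉ B) (hAB : Disjoint A B) {a b : ℝ} (ha0 : 0 < a) (hb0 : 0 < b)
    (ha : ∀ x ∈ A, X.1 x = a) (hb : ∀ x ∈ B, X.1 x = b) (m : ℕ) (hcA : A.card = 2 ^ (m + 2))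
    (hcB : 2 ^ (2 * m + 3) ≤ B.card) (h₀ : 1 / 4 ≤ X.1 x₀) (h₁ : 1 / 4 ≤ A.card * a) :
    FoolsWithGain X (m / 8 - 1) := by
  rintro D ⟨f, rfl⟩
  set c := f x₀ with hc
  have hm : (0 : ℝ) ≤ m := Nat.cast_nonneg m
  have cA := card_filter_bool A f c
  have cB := card_filter_bool B f c
  have e₁ : 2 ^ (m + 2) = 2 ^ (m + 1) + 2 ^ (m + 1) := by ring
  have e₂ : 2 ^ (2 * m + 3) = 2 ^ (2 * m + 2) + 2 ^ (2 * m + 2) := by ring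
  have fool : ∀ (c' : Bool) (U V : Finset (Cube n)) (a b : ℝ), Disjoint U V → U.Nonempty →
      0 < a → 0 < b → (∀ x ∈ U, X.1 x = a) → (∀ x ∈ V, X.1 x = b) → (∀ x ∈ U, f x = c') →
      (∀ x ∈ V, f x = c') → ∀ s : ℕ, 2 ^ s * U.card ≤ V.card → m ≤ s →
      1 / 8 ≤ U.card * a → ∃ Y : Dist n,
        expect (fun x => if f x = true then 1 else 0) Y =
          expect (fun x => if f x = true then 1 else 0) X ∧
        shannonEntropy X + (m / 8 - 1) ≤ shannonEntropy Y := by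
    intro c' U V a b h1 h2 h3 h4 h5 h6 h7 h8 s h9 h10 h11
    obtain ⟨Y, hY, hY'⟩ := exists_merge_large X (fun x => if f x = true then 1 else 0)
      (if c' = true then 1 else 0) U V h1 h2 h3 h4 h5 h6 (fun x hx => by rw [h7 x hx])
      (fun x hx => by rw [h8 x hx]) s h9 h11
    refine ⟨Y, hY, le_trans ?_ hY'⟩
    have : (m : ℝ) ≤ s := by exact_mod_cast h10
    linarith
  -- If at least half of `A` or of `B` shares the value of `x₀`, that part is merged with `x₀`.
  -- Otherwise at least half of each has the other value, and these parts are merged: half of `B` is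
  -- still `2 ^ m` times all of `A`, and half of `A` has mass at least 1/8.
  by_cases hA1 : 2 ^ (m + 1) ≤ (A.filter fun x => f x = c).card
  · refine fool c {x₀} (A.filter fun x => f x = c) (X.1 x₀) a ?_ (by simp) (by linarith) ha0
      (by simp) (fun x hx => ha x (Finset.mem_filter.1 hx).1) (by simp [hc])
      (fun x hx => (Finset.mem_filter.1 hx).2) (m + 1) (by simpa using hA1) (by omega) ?_
    · simp [hA]
    · simp only [Finset.card_singleton, Nat.cast_one]; linarith
  by_cases hB1 : 2 ^ (2 * m + 2) ≤ (B.filter fun x => f x = c).card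
  · refine fool c {x₀} (B.filter fun x => f x = c) (X.1 x₀) b ?_ (by simp) (by linarith) hb0
      (by simp) (fun x hx => hb x (Finset.mem_filter.1 hx).1) (by simp [hc])
      (fun x hx => (Finset.mem_filter.1 hx).2) (2 * m + 2) (by simpa using hB1) (by omega) ?_
    · simp [hB]
    · simp only [Finset.card_singleton, Nat.cast_one]; linarith
  have hA2 : 2 ^ (m + 1) ≤ (A.filter fun x => f x = !c).card := by omega
  have hB2 : 2 ^ (2 * m + 2) ≤ (B.filter fun x => f x = !c).card := by omega
  refine fool (!c) (A.filter fun x => f x = !c) (B.filter fun x => f x = !c) a b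
    (Finset.disjoint_filter_filter hAB) (Finset.card_pos.1 (lt_of_lt_of_le (by positivity) hA2))
    ha0 hb0 (fun x hx => ha x (Finset.mem_filter.1 hx).1)
    (fun x hx => hb x (Finset.mem_filter.1 hx).1) (fun x hx => (Finset.mem_filter.1 hx).2)
    (fun x hx => (Finset.mem_filter.1 hx).2) m ?_ le_rfl ?_
  · refine le_trans ?_ hB2
    calc 2 ^ m * (A.filter fun x => f x = !c).card ≤ 2 ^ m * 2 ^ (m + 2) := by
          gcongr
          rw [← hcA]
          exact Finset.card_filter_le _ _
      _ = 2 ^ (2 * m + 2) := by ring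
  · have : (A.card : ℝ) ≤ 2 * (A.filter fun x => f x = !c).card := by
      rw [hcA, e₁]
      exact_mod_cast (by omega)
    have := mul_le_mul_of_nonneg_right this ha0.le
    linarith

/-- The distribution with density proportional to `2 ^ (t * D x)`. -/
noncomputable def tilt {n : ℕ} (t : ℝ) (D : Cube n → ℝ) : Dist n :=
  ⟨fun x => (2 : ℝ) ^ (t * D x) / ∑ y, (2 : ℝ) ^ (t * D y),
    fun x => by positivity, by
      rw [← Finset.sum_div]
      refine div_self (ne_of_gt (Finset.sum_pos (fun x _ => by positivity) ?_))
      exact Finset.univ_nonempty⟩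

theorem sum_tilt_pos {n : ℕ} (t : ℝ) (D : Cube n → ℝ) : 0 < ∑ y, (2 : ℝ) ^ (t * D y) :=
  Finset.sum_pos (fun x _ => by positivity) Finset.univ_nonempty

theorem tilt_pos {n : ℕ} (t : ℝ) (D : Cube n → ℝ) (x : Cube n) : 0 < (tilt t D).1 x :=
  div_pos (by positivity) (sum_tilt_pos t D)

theorem logb_tilt {n : ℕ} (t : ℝ) (D : Cube n → ℝ) (x : Cube n) :
    logb 2 ((tilt t D).1 x) = t * D x - logb 2 (∑ y, (2 : ℝ) ^ (t * D y)) := by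
  unfold tilt
  rw [logb_div (by positivity) (sum_tilt_pos t D).ne', logb_rpow two_pos (by norm_num)]

/-! ### The tilted three-level distribution and its gain -/

theorem exists_level_sets {n : ℕ} (hn : 2 ≤ n) : ∃ (x₀ : Cube n) (A : Finset (Cube n)),
    x₀ ∉ A ∧ A.card = 2 ^ (n / 2) ∧ ((insert x₀ A)ᶜ).card + (2 ^ (n / 2) + 1) = 2 ^ n ∧
      ((insert x₀ A)ᶜ).Nonempty := by
  have hlt : 2 ^ (n / 2) + 1 < 2 ^ n := by
    have h1 : 2 ^ (n / 2 + 1) ≤ 2 ^ n := Nat.pow_le_pow_right two_pos (by omega)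
    have h2 : 2 ^ 1 ≤ 2 ^ (n / 2) := Nat.pow_le_pow_right two_pos (by omega)
    rw [pow_succ] at h1
    omega
  have hcard : Fintype.card (Cube n) = 2 ^ n := by simp
  obtain ⟨A, hA, hcA⟩ := Finset.exists_subset_card_eq
    (s := ({fun _ => false} : Finset (Cube n))ᶜ) (n := 2 ^ (n / 2)) (by
      rw [Finset.card_compl, hcard, Finset.card_singleton]; omega)
  have hx : (fun _ => false : Cube n) ∉ A := fun h => by simpa using hA h
  have hc : ((insert (fun _ => false) A : Finset (Cube n))ᶜ).card + (2 ^ (n / 2) + 1) = 2 ^ n := by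
    rw [Finset.card_compl, Finset.card_insert_of_notMem hx, hcard, hcA]; omega
  exact ⟨fun _ => false, A, hx, hcA, hc, Finset.card_pos.1 (by omega)⟩

section

variable {n : ℕ} {x₀ : Cube n} {A : Finset (Cube n)} (m : ℕ)

theorem rpow_threeLevel_self :
    (2 : ℝ) ^ ((2 * m : ℕ) * threeLevel x₀ A x₀ : ℝ) = 2 ^ (2 * m) := by
  rw [threeLevel, if_pos rfl, mul_one, rpow_natCast]

/-- The tilt `2 * m` is even so that the value 1/2 gives an integral power. -/
theorem rpow_threeLevel_mem (hA : x₀ ∉ A) {x : Cube n} (hx : x ∈ A) :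
    (2 : ℝ) ^ ((2 * m : ℕ) * threeLevel x₀ A x : ℝ) = 2 ^ m := by
  rw [threeLevel, if_neg (ne_of_mem_of_not_mem hx hA), if_pos hx, ← rpow_natCast]
  congr 1
  push_cast
  ring

theorem rpow_threeLevel_compl {x : Cube n} (hx : x ∈ (insert x₀ A)ᶜ) :
    (2 : ℝ) ^ ((2 * m : ℕ) * threeLevel x₀ A x : ℝ) = 1 := by
  simp only [Finset.mem_compl, Finset.mem_insert, not_or] at hx
  rw [threeLevel, if_neg hx.1, if_neg hx.2, mul_zero, rpow_zero]

theorem sum_rpow_threeLevel (hA : x₀ ∉ A) :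
    ∑ x, (2 : ℝ) ^ ((2 * m : ℕ) * threeLevel x₀ A x : ℝ) =
      2 ^ (2 * m) + A.card * 2 ^ m + ((insert x₀ A)ᶜ).card := by
  rw [← Finset.sum_add_sum_compl (insert x₀ A), Finset.sum_insert hA, rpow_threeLevel_self,
    Finset.sum_congr rfl fun x hx => rpow_threeLevel_mem m hA hx]
  rw [Finset.sum_congr (s₁ := (insert x₀ A)ᶜ) rfl fun x hx => rpow_threeLevel_compl m hx]
  simp

end

theorem exists_foolsWithGain_tilt {n : ℕ} (hn : 2 ≤ n) {x₀ : Cube n} {A : Finset (Cube n)}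
    (hA : x₀ ∉ A) (hcA : A.card = 2 ^ (n / 2)) (hB : ((insert x₀ A)ᶜ).Nonempty) :
    ∃ g > 0, FoolsWithGain (tilt (2 * (n / 2) : ℕ) (threeLevel x₀ A)) g := by
  obtain ⟨z, hz⟩ := hB
  obtain ⟨y, hy⟩ : A.Nonempty := Finset.card_pos.1 (by rw [hcA]; positivity)
  have hm : 0 < n / 2 := by omega
  have hW := (sum_tilt_pos (2 * (n / 2) : ℕ) (threeLevel x₀ A)).ne'
  have h₁ : (1 : ℝ) < 2 ^ (n / 2) := one_lt_pow₀ one_lt_two hm.ne'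
  have h₂ : (2 : ℝ) ^ (n / 2) < 2 ^ (2 * (n / 2)) := pow_lt_pow_right₀ one_lt_two (by omega)
  refine exists_foolsWithGain _ x₀ y z ?_ ?_ ?_ <;> simp only [tilt, ne_eq, div_left_inj' hW]
  · rw [rpow_threeLevel_self, rpow_threeLevel_mem _ hA hy]; exact h₂.ne'
  · rw [rpow_threeLevel_mem _ hA hy, rpow_threeLevel_compl _ hz]; exact h₁.ne'
  · rw [rpow_threeLevel_self, rpow_threeLevel_compl _ hz]; exact (h₁.trans h₂).ne'

theorem foolsWithGain_tilt {n : ℕ} (hn : 40 ≤ n) {x₀ : Cube n} {A : Finset (Cube n)}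
    (hA : x₀ ∉ A) (hcA : A.card = 2 ^ (n / 2))
    (hcB : ((insert x₀ A)ᶜ).card + (2 ^ (n / 2) + 1) = 2 ^ n) :
    FoolsWithGain (tilt (2 * (n / 2) : ℕ) (threeLevel x₀ A)) (1 / 48 * n) := by
  obtain ⟨m, hm⟩ : ∃ m, n / 2 = m + 2 := ⟨n / 2 - 2, by omega⟩
  have hW := sum_rpow_threeLevel (n / 2) hA
  have hW0 := sum_tilt_pos (2 * (n / 2) : ℕ) (threeLevel x₀ A)
  -- The factor 2 allows for odd `n`. The weights of `x₀`, `A` and the rest are then at most 1, 1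
  -- and 2 times `2 ^ (2 * (n / 2))`, with equality for the first two, whence the masses of at least
  -- 1/4.
  have hB2 : ((insert x₀ A)ᶜ).card ≤ 2 * 2 ^ (2 * (n / 2)) := by
    rw [← pow_succ']
    exact (Nat.le_of_add_right_le hcB.le).trans (Nat.pow_le_pow_right two_pos (by omega))
  have hW4 : ∑ x, (2 : ℝ) ^ ((2 * (n / 2) : ℕ) * threeLevel x₀ A x : ℝ) ≤
      4 * 2 ^ (2 * (n / 2)) := by
    have h : (((insert x₀ A)ᶜ).card : ℝ) ≤ 2 * 2 ^ (2 * (n / 2)) := by exact_mod_cast hB2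
    have e : (2 : ℝ) ^ (n / 2) * 2 ^ (n / 2) = 2 ^ (2 * (n / 2)) := by rw [← pow_add, two_mul]
    rw [hW, hcA]
    push_cast
    linarith
  have key := foolsWithGain_of_levels (tilt (2 * (n / 2) : ℕ) (threeLevel x₀ A)) x₀ A
    (insert x₀ A)ᶜ hA (by simp)
    (disjoint_compl_right.mono_left (Finset.subset_insert x₀ A))
    (div_pos (by positivity : (0 : ℝ) < 2 ^ (n / 2)) hW0) (div_pos one_pos hW0)
    (fun x hx => by simp only [tilt]; rw [rpow_threeLevel_mem _ hA hx])
    (fun x hx => by simp only [tilt]; rw [rpow_threeLevel_compl _ hx]) m (by rw [hcA, hm]) ?_ ?_ ?_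
  -- The slope 1/48 lies far enough below 1/16 for `m / 8` to absorb the loss of one bit.
  · refine key.mono ?_
    have h1 : n ≤ 2 * m + 5 := by omega
    have h2 : 18 ≤ m := by omega
    have h1' : (n : ℝ) ≤ 2 * m + 5 := by exact_mod_cast h1
    have h2' : (18 : ℝ) ≤ m := by exact_mod_cast h2
    linarith
  · have h1 : 2 ^ (2 * m + 4) ≤ 2 ^ n := Nat.pow_le_pow_right two_pos (by omega)
    have h2 : 2 ^ (m + 3) ≤ 2 ^ (2 * m + 3) := Nat.pow_le_pow_right two_pos (by omega)
    have h3 : 2 ^ (2 * m + 4) = 2 * 2 ^ (2 * m + 3) := by ring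
    have h4 : 2 ^ (m + 3) = 2 * 2 ^ (m + 2) := by ring
    have h5 : 0 < 2 ^ (m + 2) := by positivity
    rw [hm] at hcB
    omega
  · simp only [tilt]
    rw [rpow_threeLevel_self, le_div_iff₀ hW0]
    linarith
  · rw [hcA, mul_div_assoc', le_div_iff₀ hW0]
    have e : (2 : ℝ) ^ (n / 2) * 2 ^ (n / 2) = 2 ^ (2 * (n / 2)) := by rw [← pow_add, two_mul]
    rw [Nat.cast_pow, Nat.cast_ofNat, e]
    linarith

/-- A family of positive thresholds which is bounded below for large indices is bounded below. -/
theorem exists_uniform_pos {p : ℕ → ℝ → Prop} (hp : ∀ n g g', p n g → g' ≤ g → p n g')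
    (hsmall : ∀ n, ∃ g > 0, p n g) {N : ℕ} {g₀ : ℝ} (hg₀ : 0 < g₀) (hlarge : ∀ n ≥ N, p n g₀) :
    ∃ g > 0, ∀ n, p n g := by
  induction N generalizing g₀ with
  | zero => exact ⟨g₀, hg₀, fun n => hlarge n n.zero_le⟩
  | succ N ih =>
    obtain ⟨g₁, hg₁, h₁⟩ := hsmall N
    refine ih (lt_min hg₀ hg₁) fun n hn => ?_
    rcases hn.eq_or_lt with rfl | hn
    · exact hp _ _ _ h₁ (min_le_right _ _)
    · exact hp _ _ _ (hlarge n hn) (min_le_left _ _)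

theorem exists_threeLevel_foolsWithGain : ∃ g > 0, ∀ n : ℕ, 2 ≤ n →
    ∃ (x₀ : Cube n) (A : Finset (Cube n)),
      FoolsWithGain (tilt (2 * (n / 2) : ℕ) (threeLevel x₀ A)) (g * n) := by
  refine exists_uniform_pos (p := fun n g => 2 ≤ n → ∃ (x₀ : Cube n) (A : Finset (Cube n)),
    FoolsWithGain (tilt (2 * (n / 2) : ℕ) (threeLevel x₀ A)) (g * n)) ?_ ?_ (N := 40)
    (by norm_num : (0 : ℝ) < 1 / 48) ?_
  · intro n g g' h hg hn
    obtain ⟨x₀, A, h⟩ := h hn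
    exact ⟨x₀, A, h.mono (by gcongr)⟩
  · intro n
    by_cases hn : 2 ≤ n
    · obtain ⟨x₀, A, hA, hcA, -, hB⟩ := exists_level_sets hn
      obtain ⟨g, hg, h⟩ := exists_foolsWithGain_tilt hn hA hcA hB
      have hn0 : (0 : ℝ) < n := by exact_mod_cast (by omega : 0 < n)
      exact ⟨g / n, div_pos hg hn0, fun _ => ⟨x₀, A, by rwa [div_mul_cancel₀ _ hn0.ne']⟩⟩
    · exact ⟨1, one_pos, fun h => absurd h hn⟩
  · intro n hn hn2
    obtain ⟨x₀, A, hA, hcA, hcB, -⟩ := exists_level_sets hn2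
    exact ⟨x₀, A, foolsWithGain_tilt hn hA hcA hcB⟩

/-! ### Bounds on the two metric entropies -/

theorem le_metricShannonEntropy_detBool {n : ℕ} {X : Dist n} {g : ℝ} (h : FoolsWithGain X g) :
    shannonEntropy X + g ≤ metricShannonEntropy (detBool n) 0 X := by
  refine le_csSup (metricSet_bddAbove (detBool_nonempty n) 0 X) fun D hD => ?_
  obtain ⟨Y, h₁, h₂⟩ := h D hD
  exact ⟨Y, h₂, by simp [h₁]⟩

theorem metricShannonEntropy_tilt_le {n : ℕ} {t ε : ℝ} (ht : 0 ≤ t) (hε : 0 ≤ ε)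
    {D : Cube n → ℝ} {𝒟 : Set (Cube n → ℝ)} (hD : D ∈ 𝒟) :
    metricShannonEntropy 𝒟 ε (tilt t D) ≤ shannonEntropy (tilt t D) + t * ε := by
  refine csSup_le (metricSet_nonempty 𝒟 hε _) fun k hk => ?_
  obtain ⟨Y, h₁, h₂⟩ := hk D hD
  have h₃ := shannonEntropy_le_of_affine (tilt t D) (tilt_pos t D) D t _ (logb_tilt t D) Y
  have h₄ := mul_le_mul_of_nonneg_left ((le_abs_self _).trans h₂) ht
  linarith

end MetricEntropy

theorem mainTheorem5 :
    ∃ c δ ε : ℝ, 0 < c ∧ c < 1 ∧ 0 < δ ∧ 0 < ε ∧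
      ∀ n : ℕ, 2 ≤ n → ∃ (X : MetricEntropy.Dist n) (k : ℝ),
        c * n ≤ k ∧
        MetricEntropy.metricShannonEntropy (MetricEntropy.detBool n) 0 X = k ∧
        MetricEntropy.metricShannonEntropy (MetricEntropy.randCircuits n) ε X ≤ k - δ * n := by
  obtain ⟨g, hg, h⟩ := MetricEntropy.exists_threeLevel_foolsWithGain
  -- The tolerance `g / 2` costs at most `n * g / 2` bits, half of the deterministic gain; the other
  -- half is `δ * n`. The minimum with 1/2 only ensures `c < 1`.
  refine ⟨min g (1 / 2), g / 2, g / 2, lt_min hg (by norm_num),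
    (min_le_right _ _).trans_lt (by norm_num), half_pos hg, half_pos hg, fun n hn => ?_⟩
  obtain ⟨x₀, A, hX⟩ := h n hn
  have hdet := MetricEntropy.le_metricShannonEntropy_detBool hX
  refine ⟨MetricEntropy.tilt (2 * (n / 2) : ℕ) (MetricEntropy.threeLevel x₀ A), _, ?_, rfl, ?_⟩
  · have h₀ := MetricEntropy.shannonEntropy_nonneg
      (MetricEntropy.tilt (2 * (n / 2) : ℕ) (MetricEntropy.threeLevel x₀ A))
    have : min g (1 / 2) * n ≤ g * n := by gcongr; exact min_le_left _ _
    linarith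
  · have hrand := MetricEntropy.metricShannonEntropy_tilt_le (Nat.cast_nonneg (2 * (n / 2)))
      (half_pos hg).le (MetricEntropy.threeLevel_mem_randCircuits x₀ A)
    have ht : ((2 * (n / 2) : ℕ) : ℝ) ≤ n := by exact_mod_cast Nat.mul_div_le n 2
    have ht' := mul_le_mul_of_nonneg_right ht (half_pos hg).le
    linarith
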